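/- All graphs are finite and simple. A chordless cycle of a graph $G$ is a cycle (with at least three vertices) that occurs as an induced subgraph of $G$. An orientation of $G$, i.e. a choice of an ordering of the two endpoints of every edge, is called cyclic if its restriction to every chordless cycle $v_1, v_2, \dots, v_k, v_1$ of $G$ is either $(v_1,v_2), \dots, (v_{k-1},v_k), (v_k,v_1)$ or the opposite of this orientation. The graph $G$ is called cyclically orientable if it has a cyclic orientation. **Proposition.** Let $G$ be a cyclically orientable graph with $n \ge 2$ vertices. Then $G$ has at most $2n-3$ edges. -/

import Mathlib

namespace SimpleGraph

/-- An orientation of a graph `G`: for every edge of `G`, a choice of one of the two orderings of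
its endpoints. `O.Arc u v` says that the edge `{u, v}` is ordered as `(u, v)`. -/
structure EdgeOrientation {V : Type*} (G : SimpleGraph V) where
  Arc : V → V → Prop
  adj_iff : ∀ u v : V, G.Adj u v ↔ Arc u v ∨ Arc v u
  asymm : ∀ u v : V, Arc u v → ¬ Arc v u

/-- A closed walk `p` running once around a cycle is cyclically oriented by `O` if all of its edges
are oriented in the direction in which `p` runs, or all of them in the opposite direction. -/
def EdgeOrientation.OrientsCyclically {V : Type*} {G : SimpleGraph V} (O : G.EdgeOrientation)
    {v : V} (p : G.Walk v v) : Prop :=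
  (∀ d ∈ p.darts, O.Arc d.fst d.snd) ∨ (∀ d ∈ p.darts, O.Arc d.snd d.fst)

/-- An orientation is cyclic if its restriction to every chordless cycle (a cycle that occurs as
an induced subgraph) is cyclic. -/
def EdgeOrientation.IsCyclic {V : Type*} {G : SimpleGraph V} (O : G.EdgeOrientation) : Prop :=
  ∀ (v : V) (p : G.Walk v v), p.IsCycle → p.toSubgraph.IsInduced → O.OrientsCyclically p

/-- A graph is cyclically orientable if it has a cyclic orientation. -/
def CyclicallyOrientable {V : Type*} (G : SimpleGraph V) : Prop :=
  ∃ O : G.EdgeOrientation, O.IsCyclic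

end SimpleGraph

/-!
A vertex `v` is *avoidable* if any two of its neighbours are joined by a walk whose inner vertices
lie outside the closed neighbourhood of `v`. A shortest such walk closes up through `v` to a
chordless cycle, so in a cyclic orientation exactly one of the two edges leaves `v`. No three edges
at `v` can be pairwise opposite in this way, hence an avoidable vertex has degree at most two.
Every finite nonempty graph has an avoidable vertex (Ohtsuki, Cheung and Fujisawa), and cyclic
orientability passes to induced subgraphs, so a cyclically orientable graph is `2`-degenerate;
removing vertices of degree at most two one at a time gives the bound.
-/

open Finset SimpleGraph

namespace CyclicOrientation

variable {V W : Type*} {G : SimpleGraph V} {H : SimpleGraph W}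

section Chordless

variable {x y : V} {p : G.Walk x y}

theorem mem_edges_of_isSubwalk_of_length_eq_dist (hp : p.length = G.dist x y) {a b : V}
    {q : G.Walk a b} (hqp : q.IsSubwalk p) (hab : G.Adj a b) : s(a, b) ∈ p.edges := by
  have hq : q.length = 1 := (length_eq_dist_of_subwalk hp hqp).trans (dist_eq_one_iff_adj.mpr hab)
  refine hqp.edges_subset ?_
  match q, hq with
  | .cons _ .nil, _ => simp

theorem isChordless_of_length_eq_dist (hp : p.length = G.dist x y) : p.IsChordless := by
  rw [Walk.isChordless_iff_forall_mem_edges]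
  intro a b ha hb hab
  obtain ⟨q, r, rfl⟩ := Walk.mem_support_iff_exists_append.mp ha
  rcases (Walk.mem_support_append_iff q r).mp hb with hbq | hbr
  · obtain ⟨s, t, rfl⟩ := Walk.mem_support_iff_exists_append.mp hbq
    rw [Sym2.eq_swap]
    exact mem_edges_of_isSubwalk_of_length_eq_dist hp ⟨s, r, rfl⟩ hab.symm
  · obtain ⟨s, t, rfl⟩ := Walk.mem_support_iff_exists_append.mp hbr
    exact mem_edges_of_isSubwalk_of_length_eq_dist hp ⟨q, t, Walk.append_assoc ..⟩ hab

theorem mem_support_map_iff {f : G →g H} {z : W} :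
    z ∈ (p.map f).support ↔ ∃ w ∈ p.support, f w = z := by
  rw [Walk.support_map, List.mem_map]

theorem isChordless_map (hp : p.IsChordless) (f : G ↪g H) : (p.map f.toHom).IsChordless := by
  rw [Walk.isChordless_iff_forall_mem_edges] at hp ⊢
  intro a b ha hb hab
  obtain ⟨a, hap, rfl⟩ := mem_support_map_iff.mp ha
  obtain ⟨b, hbp, rfl⟩ := mem_support_map_iff.mp hb
  rw [Walk.edges_map, List.mem_map]
  exact ⟨s(a, b), hp hap hbp (f.map_adj_iff.mp hab), rfl⟩

theorem exists_isPath_isChordless_support_subset (p : G.Walk x y) :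
    ∃ q : G.Walk x y, q.IsPath ∧ q.IsChordless ∧ q.support ⊆ p.support := by
  let f := Embedding.induce (G := G) {z | z ∈ p.support}
  obtain ⟨q, hq⟩ := (p.induce {z | z ∈ p.support} fun _ ↦ id).reachable.exists_walk_length_eq_dist
  refine ⟨q.map f.toHom, (q.isPath_of_length_eq_dist hq).map f.injective,
    isChordless_map (isChordless_of_length_eq_dist hq) f, fun z hz ↦ ?_⟩
  obtain ⟨w, -, rfl⟩ := mem_support_map_iff.mp hz
  exact w.2

end Chordless

section Detour

variable {v x y : V}

/-- A walk from `x` to `y` is a detour around `v` if it avoids `v` and all neighbours of `v` other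
than `x` and `y`. It is meant for neighbours `x` and `y` of `v`, where it replaces the walk
`x, v, y`. -/
def IsDetour (v : V) (p : G.Walk x y) : Prop :=
  ∀ z ∈ p.support, z ≠ v ∧ (G.Adj v z → z = x ∨ z = y)

theorem IsDetour.of_support_subset {p q : G.Walk x y} (hp : IsDetour v p)
    (hqp : q.support ⊆ p.support) : IsDetour v q :=
  fun z hz ↦ hp z (hqp hz)

theorem isDetour_toWalk (hx : x ≠ v) (hy : y ≠ v) (hxy : G.Adj x y) :
    IsDetour v hxy.toWalk := by
  intro z hz
  rcases (by simpa using hz : z = x ∨ z = y) with rfl | rfl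
  · exact ⟨hx, fun _ ↦ .inl rfl⟩
  · exact ⟨hy, fun _ ↦ .inr rfl⟩

theorem IsDetour.notMem_support {p : G.Walk x y} (hp : IsDetour v p) : v ∉ p.support :=
  fun h ↦ (hp v h).1 rfl

theorem isCycle_cons_concat {p : G.Walk x y} (hp : p.IsPath) (hv : v ∉ p.support) (hxy : x ≠ y)
    (hx : G.Adj v x) (hy : G.Adj v y) : (Walk.cons hx (p.concat hy.symm)).IsCycle := by
  refine (Walk.cons_isCycle_iff _ _).mpr ⟨hp.concat hv hy.symm, fun h ↦ ?_⟩
  rw [Walk.edges_concat, List.concat_eq_append, List.mem_append, List.mem_singleton] at h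
  rcases h with h | h
  · exact hv (p.fst_mem_support_of_mem_edges h)
  · rcases Sym2.eq_iff.mp h with ⟨hvy, -⟩ | ⟨-, hxy'⟩
    · exact hy.ne hvy
    · exact hxy hxy'

theorem IsDetour.isChordless_cons_concat {p : G.Walk x y} (hp : IsDetour v p)
    (hchord : p.IsChordless) (hx : G.Adj v x) (hy : G.Adj v y) :
    (Walk.cons hx (p.concat hy.symm)).IsChordless := by
  have hedges : (Walk.cons hx (p.concat hy.symm)).edges = s(v, x) :: (p.edges ++ [s(v, y)]) := by
    simp [Walk.edges_concat, Sym2.eq_swap]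
  have hspoke : ∀ b ∈ p.support, G.Adj v b → s(v, b) ∈ s(v, x) :: (p.edges ++ [s(v, y)]) := by
    intro b hb hvb
    rcases (hp b hb).2 hvb with rfl | rfl <;> simp
  have hmem : ∀ a ∈ (Walk.cons hx (p.concat hy.symm)).support, a = v ∨ a ∈ p.support := by
    intro a ha
    simpa [Walk.support_concat, or_comm, or_assoc] using ha
  rw [Walk.isChordless_iff_forall_mem_edges, hedges]
  intro a b ha hb hab
  rcases hmem a ha with rfl | hap <;> rcases hmem b hb with rfl | hbp
  · exact (hab.ne rfl).elim
  · exact hspoke b hbp hab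
  · rw [Sym2.eq_swap (a := a)]
    exact hspoke a hap hab.symm
  · simp [hchord.mem_edges hap hbp hab]

theorem IsDetour.arc_iff_not_arc {O : G.EdgeOrientation} (hO : O.IsCyclic) {p : G.Walk x y}
    (hp : IsDetour v p) (hxy : x ≠ y) (hx : G.Adj v x) (hy : G.Adj v y) :
    O.Arc v x ↔ ¬ O.Arc v y := by
  obtain ⟨q, hpath, hchord, hqp⟩ := exists_isPath_isChordless_support_subset p
  have hq : IsDetour v q := hp.of_support_subset hqp
  let c : G.Walk v v := .cons hx (q.concat hy.symm)
  have hxc : (⟨(v, x), hx⟩ : G.Dart) ∈ c.darts := by simp [c]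
  have hyc : (⟨(y, v), hy.symm⟩ : G.Dart) ∈ c.darts := by simp [c, Walk.darts_concat]
  rcases hO v c (isCycle_cons_concat hpath hq.notMem_support hxy hx hy)
    (Walk.isInduced_toSubgraph.mpr (hq.isChordless_cons_concat hchord hx hy)) with h | h
  · exact iff_of_true (h _ hxc) (O.asymm _ _ (h _ hyc))
  · exact iff_of_false (O.asymm _ _ (h _ hxc)) (not_not_intro (h _ hyc))

end Detour

section Avoidable

/-- A vertex is avoidable if any two of its neighbours are joined by a detour around it. This is the
usual notion, that every induced path `x, v, y` extends to an induced cycle: for adjacent `x` and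
`y` the edge between them is a detour. -/
def IsAvoidable (G : SimpleGraph V) (v : V) : Prop :=
  ∀ ⦃x y : V⦄, G.Adj v x → G.Adj v y → x ≠ y → ∃ p : G.Walk x y, IsDetour v p

theorem IsAvoidable.encard_neighborSet_le_two {v : V} (hv : IsAvoidable G v)
    (hG : G.CyclicallyOrientable) : (G.neighborSet v).encard ≤ 2 := by
  obtain ⟨O, hO⟩ := hG
  have opposite : ∀ {x y}, G.Adj v x → G.Adj v y → x ≠ y → (O.Arc v x ↔ ¬ O.Arc v y) :=
    fun hx hy hxy ↦
      let ⟨_, hp⟩ := hv hx hy hxy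
      hp.arc_iff_not_arc hO hxy hx hy
  by_contra! hcard
  obtain ⟨T, hT, hTcard⟩ := Set.exists_subset_encard_eq (Order.add_one_le_of_lt hcard)
  obtain ⟨a, b, c, hab, hac, hbc, rfl⟩ := Set.encard_eq_three.mp hTcard
  have ha : G.Adj v a := hT (by simp)
  have hb : G.Adj v b := hT (by simp)
  have hc : G.Adj v c := hT (by simp)
  have := opposite ha hb hab
  have := opposite ha hc hac
  have := opposite hb hc hbc
  tauto

/-- The vertices of `G` that neither belong to `C` nor have a neighbour in `C`. -/
def nonNeighbors (G : SimpleGraph V) (C : Set V) : Set V :=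
  {r | r ∉ C ∧ ∀ c ∈ C, ¬ G.Adj c r}

theorem exists_walk_of_preconnected_induce {C : Set V} (hC : (G.induce C).Preconnected) {a b : V}
    (ha : a ∈ C) (hb : b ∈ C) : ∃ p : G.Walk a b, ∀ z ∈ p.support, z ∈ C := by
  obtain ⟨p⟩ := hC ⟨a, ha⟩ ⟨b, hb⟩
  refine ⟨p.map (Embedding.induce C).toHom, fun z hz ↦ ?_⟩
  obtain ⟨w, -, rfl⟩ := mem_support_map_iff.mp hz
  exact w.2

theorem exists_isDetour_of_mem_nonNeighbors {C : Set V} (hC : (G.induce C).Preconnected)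
    {v x y c d : V} (hv : v ∈ nonNeighbors G C) (hx : x ≠ v) (hy : y ≠ v) (hc : c ∈ C)
    (hd : d ∈ C) (hcx : G.Adj c x) (hdy : G.Adj d y) : ∃ p : G.Walk x y, IsDetour v p := by
  obtain ⟨p, hp⟩ := exists_walk_of_preconnected_induce hC hc hd
  refine ⟨.cons hcx.symm (p.concat hdy), fun z hz ↦ ?_⟩
  have hz' : z = x ∨ z ∈ p.support ∨ z = y := by simpa [Walk.support_concat] using hz
  rcases hz' with rfl | hzp | rfl
  · exact ⟨hx, fun _ ↦ .inl rfl⟩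
  · exact ⟨ne_of_mem_of_not_mem (hp z hzp) hv.1, fun h ↦ (hv.2 z (hp z hzp) h.symm).elim⟩
  · exact ⟨hy, fun _ ↦ .inr rfl⟩

theorem IsDetour.map_induce {S : Set V} {v x y : S} {p : (G.induce S).Walk x y}
    (hp : IsDetour v p) : IsDetour (v : V) (p.map (Embedding.induce S).toHom) := by
  intro z hz
  obtain ⟨w, hw, rfl⟩ := mem_support_map_iff.mp hz
  exact ⟨fun h ↦ (hp w hw).1 (Subtype.ext h),
    fun h ↦ ((hp w hw).2 h).imp (congrArg _) (congrArg _)⟩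

theorem isAvoidable_of_isAvoidable_induce_nonNeighbors {C : Set V}
    (hC : (G.induce C).Preconnected)
    (hboundary : ∀ c ∈ C, ∀ a ∉ C, G.Adj c a → ∀ r ∈ nonNeighbors G C, G.Adj a r)
    {v : nonNeighbors G C} (hv : IsAvoidable (G.induce (nonNeighbors G C)) v) :
    IsAvoidable G v := by
  have hcases : ∀ {x}, G.Adj v x → x ∈ nonNeighbors G C ∨ x ∉ C ∧ ∃ c ∈ C, G.Adj c x := by
    intro x hx
    have hxC : x ∉ C := fun h ↦ v.2.2 x h hx.symm
    by_cases h : ∃ c ∈ C, G.Adj c x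
    · exact .inr ⟨hxC, h⟩
    · exact .inl ⟨hxC, by simpa using h⟩
  intro x y hx hy hxy
  rcases hcases hx with hxR | ⟨hxC, c, hc, hcx⟩ <;> rcases hcases hy with hyR | ⟨hyC, d, hd, hdy⟩
  · obtain ⟨p, hp⟩ := hv (x := ⟨x, hxR⟩) (y := ⟨y, hyR⟩) hx hy (Subtype.coe_ne_coe.mp hxy)
    exact ⟨_, hp.map_induce⟩
  · exact ⟨_, isDetour_toWalk hx.ne' hy.ne' (hboundary d hd y hyC hdy x hxR).symm⟩
  · exact ⟨_, isDetour_toWalk hx.ne' hy.ne' (hboundary c hc x hxC hcx y hyR)⟩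
  · exact exists_isDetour_of_mem_nonNeighbors hC v.2 hx.ne' hy.ne' hc hd hcx hdy

theorem exists_connected_forall_adj_nonNeighbors [Finite V] {u w : V} (huw : u ≠ w)
    (hadj : ¬ G.Adj u w) :
    ∃ C : Set V, (G.induce C).Connected ∧ (nonNeighbors G C).Nonempty ∧
      ∀ c ∈ C, ∀ a ∉ C, G.Adj c a → ∀ r ∈ nonNeighbors G C, G.Adj a r := by
  have hsingleton : (G.induce {u}).Connected ∧ (nonNeighbors G {u}).Nonempty :=
    ⟨.of_subsingleton, w, by simpa using huw.symm, by simpa using hadj⟩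
  obtain ⟨C, ⟨hC, hne⟩, hmax⟩ := Set.toFinite
    {C : Set V | (G.induce C).Connected ∧ (nonNeighbors G C).Nonempty} |>.exists_maximal
    ⟨_, hsingleton⟩
  refine ⟨C, hC, hne, fun c hc a ha hca r hr ↦ ?_⟩
  by_contra har
  have hextend : (G.induce (C ∪ {a})).Connected :=
    connected_induce_union hC.preconnected .of_subsingleton hc rfl hca
  have hr' : r ∈ nonNeighbors G (C ∪ {a}) := by
    have hra : r ≠ a := by
      rintro rfl
      exact hr.2 c hc hca
    refine ⟨by simp [hr.1, hra], ?_⟩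
    rintro z (hz | rfl)
    exacts [hr.2 z hz, har]
  exact ha (hmax ⟨hextend, r, hr'⟩ Set.subset_union_left (.inr rfl))

theorem exists_isAvoidable [Finite V] [Nonempty V] (G : SimpleGraph V) : ∃ v, IsAvoidable G v := by
  induction hn : Nat.card V using Nat.strong_induction_on generalizing V with | _ n ih =>
  by_cases hcomplete : ∀ u w, u ≠ w → G.Adj u w
  · exact ⟨Classical.arbitrary V, fun x y hx hy hxy ↦
      ⟨_, isDetour_toWalk hx.ne' hy.ne' (hcomplete x y hxy)⟩⟩
  push Not at hcomplete
  obtain ⟨u, w, huw, hadj⟩ := hcomplete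
  obtain ⟨C, hC, hne, hboundary⟩ := exists_connected_forall_adj_nonNeighbors huw hadj
  obtain ⟨c⟩ := hC.nonempty
  have hlt : Nat.card (nonNeighbors G C) < n :=
    hn ▸ Finite.card_subtype_lt (x := (c : V)) fun h ↦ h.1 c.2
  have := hne.to_subtype
  obtain ⟨v, hv⟩ := ih _ hlt (G.induce (nonNeighbors G C)) rfl
  exact ⟨v, isAvoidable_of_isAvoidable_induce_nonNeighbors hC.preconnected hboundary hv⟩

end Avoidable

section Embedding

/-- The orientation of `H` pulled back from an orientation of `G` along an embedding. -/
def comapOrientation (f : H ↪g G) (O : G.EdgeOrientation) : H.EdgeOrientation where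
  Arc u v := O.Arc (f u) (f v)
  adj_iff u v := f.map_adj_iff.symm.trans (O.adj_iff (f u) (f v))
  asymm u v := O.asymm (f u) (f v)

theorem isCyclic_comapOrientation (f : H ↪g G) {O : G.EdgeOrientation} (hO : O.IsCyclic) :
    (comapOrientation f O).IsCyclic := by
  intro v p hp hind
  have hmap := hO (f v) (p.map f.toHom) (hp.map f.injective)
    (Walk.isInduced_toSubgraph.mpr (isChordless_map (Walk.isInduced_toSubgraph.mp hind) f))
  rw [EdgeOrientation.OrientsCyclically, Walk.darts_map, List.forall_mem_map,
    List.forall_mem_map] at hmap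
  exact hmap

theorem cyclicallyOrientable_of_embedding (f : H ↪g G) (hG : G.CyclicallyOrientable) :
    H.CyclicallyOrientable :=
  let ⟨_, hO⟩ := hG
  ⟨_, isCyclic_comapOrientation f hO⟩

end Embedding

section Degenerate

variable {d : ℕ}

/-- A graph is `d`-degenerate if every nonempty finite set of vertices contains a vertex with at
most `d` neighbours in the set. -/
def IsDegenerate (G : SimpleGraph V) (d : ℕ) : Prop :=
  ∀ S : Finset V, S.Nonempty → ∃ v ∈ S, (G.neighborSet v ∩ S).encard ≤ d

theorem IsDegenerate.of_embedding (hG : IsDegenerate G d) (f : H ↪g G) : IsDegenerate H d := by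
  intro S hS
  obtain ⟨_, hv, hcard⟩ := hG (S.map f.toEmbedding) (hS.map)
  obtain ⟨v, hvS, rfl⟩ := Finset.mem_map.mp hv
  refine ⟨v, hvS, le_trans ?_ hcard⟩
  rw [← f.injective.encard_image]
  refine Set.encard_le_encard ?_
  rintro _ ⟨u, ⟨hvu, huS⟩, rfl⟩
  exact ⟨f.map_adj_iff.mpr hvu, Finset.mem_coe.mpr (Finset.mem_map_of_mem _ huS)⟩

theorem IsDegenerate.exists_degree_le [Fintype V] [Nonempty V] [DecidableRel G.Adj]
    (hG : IsDegenerate G d) : ∃ v, G.degree v ≤ d := by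
  obtain ⟨v, -, hv⟩ := hG univ univ_nonempty
  refine ⟨v, ?_⟩
  rwa [coe_univ, Set.inter_univ, ← coe_neighborFinset, Set.encard_coe_eq_coe_finsetCard,
    card_neighborFinset_eq_degree, Nat.cast_le] at hv

theorem choose_two_add_choose_succ_two (n : ℕ) : n.choose 2 + (n + 1).choose 2 = n * n := by
  induction n with
  | zero => rfl
  | succ n ih =>
    simp only [Nat.choose_succ_succ' _ 1, Nat.choose_one_right] at *
    linarith

theorem IsDegenerate.card_edgeFinset_add_choose_two_le [Fintype V] [Fintype G.edgeSet]
    (hG : IsDegenerate G d) (hd : d ≤ Fintype.card V) :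
    #G.edgeFinset + (d + 1).choose 2 ≤ d * Fintype.card V := by
  classical
  induction hd' : Fintype.card V - d generalizing V with
  | zero =>
    have hcard : Fintype.card V = d := by omega
    have hE : #G.edgeFinset ≤ d.choose 2 := by
      convert hcard ▸ G.card_edgeFinset_le_card_choose_two
    rw [hcard, ← choose_two_add_choose_succ_two]
    exact Nat.add_le_add_right hE _
  | succ k ih =>
    have : Nonempty V := Fintype.card_pos_iff.mp (by omega)
    obtain ⟨v, hv⟩ := hG.exists_degree_le
    have hcard : Fintype.card ({v}ᶜ : Set V) + 1 = Fintype.card V := by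
      rw [Fintype.card_compl_set, Set.card_singleton, Nat.sub_add_cancel Fintype.card_pos]
    have hE : #G.edgeFinset ≤ #(G.induce {v}ᶜ).edgeFinset + G.degree v := by
      rw [card_edgeFinset_induce_compl_singleton, card_edgeFinset_deleteIncidenceSet]
      convert Nat.le_add_of_sub_le le_rfl
    calc #G.edgeFinset + (d + 1).choose 2
        ≤ #(G.induce {v}ᶜ).edgeFinset + (d + 1).choose 2 + d := by omega
      _ ≤ d * Fintype.card ({v}ᶜ : Set V) + d := by
        gcongr
        exact ih (hG.of_embedding (Embedding.induce _)) (by omega) (by omega)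
      _ = d * Fintype.card V := by rw [← hcard, Nat.mul_succ]

theorem isDegenerate_two_of_cyclicallyOrientable (hG : G.CyclicallyOrientable) :
    IsDegenerate G 2 := by
  intro S hS
  have := hS.to_subtype
  obtain ⟨v, hv⟩ := exists_isAvoidable (G.induce (S : Set V))
  refine ⟨v, v.2, ?_⟩
  have hdeg := hv.encard_neighborSet_le_two (cyclicallyOrientable_of_embedding (.induce _) hG)
  rw [← Subtype.val_injective.encard_image] at hdeg
  refine le_trans (Set.encard_le_encard ?_) hdeg
  rintro u ⟨hvu, huS⟩
  exact ⟨⟨u, huS⟩, hvu, rfl⟩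

end Degenerate

end CyclicOrientation

theorem mainTheorem4 {V : Type*} [Fintype V] (G : SimpleGraph V) [Fintype G.edgeSet]
    (hV : 2 ≤ Fintype.card V) (hG : G.CyclicallyOrientable) :
    (G.edgeFinset.card : ℤ) ≤ 2 * (Fintype.card V : ℤ) - 3 := by
  have hdegenerate := CyclicOrientation.isDegenerate_two_of_cyclicallyOrientable hG
  have hcard : G.edgeFinset.card + 3 ≤ 2 * Fintype.card V :=
    hdegenerate.card_edgeFinset_add_choose_two_le hV
  omega
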